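/- Let $R$ be a commutative Noetherian ring and let $\Phi$ be a system of ideals of $R$, that is, a non-empty set of ideals of $R$ such that for all $\mathfrak a_1,\mathfrak a_2\in\Phi$ there is $\mathfrak b\in\Phi$ with $\mathfrak b\subseteq\mathfrak a_1\mathfrak a_2$. For an $R$-module $X$ put $\Gamma_\Phi(X)=\{x\in X : \mathfrak a x=0 \text{ for some } \mathfrak a\in\Phi\}$, let $H^i_\Phi(-)$ denote the $i$-th right derived functor of the functor $\Gamma_\Phi(-)$ on $R$-modules, and call $X$ $\Phi$-torsion if $\Gamma_\Phi(X)=X$. Let $\mathcal S$ be a Serre subcategory of the category of $R$-modules, i.e. a class of $R$-modules containing $0$ and closed under taking submodules, quotients and extensions. Let $M$ be an arbitrary $R$-module, let $N$ be a $\Phi$-torsion $R$-module (not necessarily finitely generated), and let $t\ge 0$ be an integer. If $\operatorname{Ext}^{t-i}_R(N,H^i_\Phi(M))\in\mathcal S$ for all integers $0\le i\le t$, then $\operatorname{Ext}^t_R(N,M)\in\mathcal S$. -/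

import Mathlib

open CategoryTheory

universe u v

/-- A system of ideals of `R`: a non-empty set `Φ` of ideals such that any product `𝔞₁𝔞₂` of two
members contains a member. -/
structure SystemOfIdeals (R : Type u) [CommRing R] where
  /-- The underlying set of ideals. -/
  ideals : Set (Ideal R)
  nonempty : ideals.Nonempty
  exists_le_mul : ∀ 𝔞₁ ∈ ideals, ∀ 𝔞₂ ∈ ideals, ∃ 𝔟 ∈ ideals, 𝔟 ≤ 𝔞₁ * 𝔞₂

namespace SystemOfIdeals

variable {R : Type u} [CommRing R] (Φ : SystemOfIdeals R)

/-- `Γ_Φ(M) = {x ∈ M | 𝔞 x = 0 for some 𝔞 ∈ Φ}`. -/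
def gamma (M : Type v) [AddCommGroup M] [Module R M] : Submodule R M where
  carrier := {x | ∃ 𝔞 ∈ Φ.ideals, ∀ r ∈ 𝔞, r • x = 0}
  zero_mem' := by
    obtain ⟨𝔞, h⟩ := Φ.nonempty
    exact ⟨𝔞, h, fun r _ => smul_zero r⟩
  add_mem' := by
    rintro x y ⟨𝔞, h𝔞, hx⟩ ⟨𝔟, h𝔟, hy⟩
    obtain ⟨𝔠, h𝔠, hle⟩ := Φ.exists_le_mul 𝔞 h𝔞 𝔟 h𝔟
    refine ⟨𝔠, h𝔠, fun r hr => ?_⟩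
    have h₁ : r ∈ 𝔞 := (hle.trans Ideal.mul_le_left) hr
    have h₂ : r ∈ 𝔟 := (hle.trans Ideal.mul_le_right) hr
    rw [smul_add, hx r h₁, hy r h₂, add_zero]
  smul_mem' := by
    rintro c x ⟨𝔞, h𝔞, hx⟩
    exact ⟨𝔞, h𝔞, fun r hr => by rw [smul_comm, hx r hr, smul_zero]⟩

theorem map_mem_gamma {M N : Type v} [AddCommGroup M] [Module R M] [AddCommGroup N] [Module R N]
    (f : M →ₗ[R] N) : ∀ x ∈ Φ.gamma M, f x ∈ Φ.gamma N := by
  rintro x ⟨𝔞, h𝔞, hx⟩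
  exact ⟨𝔞, h𝔞, fun r hr => by rw [← map_smul, hx r hr, map_zero]⟩

/-- A module `N` is `Φ`-torsion if `Γ_Φ(N) = N`. -/
def IsTorsion (N : Type v) [AddCommGroup N] [Module R N] : Prop :=
  Φ.gamma N = ⊤

/-- The functor `Γ_Φ(-)` from `R`-modules to `R`-modules; on morphisms it is restriction. -/
def gammaFunctor : ModuleCat.{v} R ⥤ ModuleCat.{v} R where
  obj M := ModuleCat.of R (Φ.gamma M)
  map f := ModuleCat.ofHom (f.hom.restrict (Φ.map_mem_gamma f.hom))

instance : (Φ.gammaFunctor : ModuleCat.{v} R ⥤ ModuleCat.{v} R).Additive where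

/-- The `i`-th general local cohomology functor `H^i_Φ(-)`: the `i`-th right derived functor of
`Γ_Φ(-)`. -/
noncomputable def localCohomology [Small.{v} R] (i : ℕ) : ModuleCat.{v} R ⥤ ModuleCat.{v} R :=
  Φ.gammaFunctor.rightDerived i

end SystemOfIdeals

/-!
For a `Φ`-torsion module `N` every morphism `N ⟶ X` lands in `Γ_Φ(X)`, so if `I` is an injective
resolution of `M` then `Extᵗ(N, M)` is the `t`-th cohomology of `Hom(N, Γ_Φ(I))`. By the Artin–Rees
lemma `Γ_Φ` preserves injectives, so `J = Γ_Φ(I)` is a complex of injectives with cohomology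
`Hⁱ_Φ(M)`. Dimension shifting along `0 → Zⁱ → Jⁱ → Bⁱ⁺¹ → 0` and `0 → Bⁱ → Zⁱ → Hⁱ → 0` then bounds
`Hᵗ(Hom(N, J))` by the modules `Extᵗ⁻ⁱ(N, Hⁱ_Φ(M))`, as in the Grothendieck spectral sequence.
The same argument works for any functor `F` preserving injectives and any `N`, `N'` with
`Hom(N, F -) ≅ Hom(N', -)`.
-/

open Limits Abelian

universe w v₁ v₂ u₁ u₂

section SerreClass

variable {A : Type u₁} [Category.{v₁} A] [Abelian A] (S : ObjectProperty A) [S.IsSerreClass]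

lemma prop_of_exact_of_epi {X Y Z P : A} {f : X ⟶ Y} {g : Y ⟶ Z} {w : f ≫ g = 0}
    (hfg : (ShortComplex.mk f g w).Exact) (hZ : S Z) (φ : Y ⟶ P) [Epi φ] (hφ : f ≫ φ = 0) :
    S P := by
  have : Mono (cokernel.desc f g w) := hfg.mono_cokernelDesc
  have : Epi (cokernel.desc f φ hφ) := epi_of_epi_fac (cokernel.π_desc f φ hφ)
  exact S.prop_of_epi (cokernel.desc f φ hφ) (S.prop_of_mono (cokernel.desc f g w) hZ)

lemma prop_of_exact_of_exact_of_epi {W X V Y Z P : A} {a : W ⟶ X} {b : X ⟶ V} {wab : a ≫ b = 0}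
    (hab : (ShortComplex.mk a b wab).Exact) (hV : S V) {f : X ⟶ Y} {g : Y ⟶ Z} {wfg : f ≫ g = 0}
    (hfg : (ShortComplex.mk f g wfg).Exact) (hZ : S Z) (φ : Y ⟶ P) [Epi φ]
    (hφ : a ≫ f ≫ φ = 0) : S P := by
  have himage : S (Abelian.image (f ≫ φ)) :=
    prop_of_exact_of_epi S hab hV (Abelian.factorThruImage (f ≫ φ))
      (by rw [← cancel_mono (Abelian.image.ι _), Category.assoc, Abelian.image.fac, hφ, zero_comp])
  have hcokernel : S (cokernel (f ≫ φ)) :=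
    prop_of_exact_of_epi S hfg hZ (φ ≫ cokernel.π (f ≫ φ))
      (by rw [← Category.assoc, cokernel.condition])
  exact S.prop_X₂_of_exact (ShortComplex.exact_kernel (cokernel.π (f ≫ φ))) himage hcokernel

end SerreClass

section Ext

variable (R : Type u) [CommRing R] {C : Type u₁} [Category.{v₁} C] [Abelian C] [Linear R C]
  [HasExt.{w} C] (N : C)

/-- Composition with a class `α`, as a morphism between `Ext` modules. -/
noncomputable def extPostcomp {X Y : C} {d : ℕ} (α : Ext.{w} X Y d) {a b : ℕ} (h : a + d = b) :
    ModuleCat.of R (Ext.{w} N X a) ⟶ ModuleCat.of R (Ext.{w} N Y b) :=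
  ModuleCat.ofHom (α.postcompOfLinear R N h)

lemma extPostcomp_mk₀_comp {X Y Z : C} (f : X ⟶ Y) (g : Y ⟶ Z) (n : ℕ) :
    extPostcomp R N (Ext.mk₀ f) (add_zero n) ≫ extPostcomp R N (Ext.mk₀ g) (add_zero n) =
      extPostcomp R N (Ext.mk₀.{w} (f ≫ g)) (add_zero n) := by
  ext; simp [extPostcomp]

variable {R} {T : ShortComplex C} (hT : T.ShortExact)
include hT

lemma ext_exact₂ (n : ℕ) :
    (ShortComplex.mk (extPostcomp R N (Ext.mk₀ T.f) (add_zero n))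
      (extPostcomp R N (Ext.mk₀ T.g) (add_zero n)) (by ext; simp [extPostcomp])).Exact :=
  (ShortComplex.moduleCat_exact_iff _).2 fun x hx => Ext.covariant_sequence_exact₂ N hT x hx

lemma ext_exact₃ {n₀ n₁ : ℕ} (hn : n₀ + 1 = n₁) :
    (ShortComplex.mk (extPostcomp R N (Ext.mk₀ T.g) (add_zero n₀))
      (extPostcomp R N hT.extClass hn) (by ext; simp [extPostcomp])).Exact :=
  (ShortComplex.moduleCat_exact_iff _).2 fun x hx => Ext.covariant_sequence_exact₃ N hT x hn hx

lemma prop_ext_X₃_of_injective (S : ObjectProperty (ModuleCat.{w} R)) [S.IsSerreClass]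
    [Injective T.X₂] {n : ℕ} (h : S (ModuleCat.of R (Ext.{w} N T.X₁ (n + 2)))) :
    S (ModuleCat.of R (Ext.{w} N T.X₃ (n + 1))) := by
  have : Subsingleton (Ext.{w} N T.X₂ (n + 1)) := Ext.subsingleton_of_injective N T.X₂ n
  exact S.prop_X₂_of_exact (ext_exact₃ N hT rfl)
    (S.prop_of_isZero (ModuleCat.isZero_of_subsingleton _)) h

omit hT

lemma prop_ext_of_iso (S : ObjectProperty (ModuleCat.{w} R)) [S.IsClosedUnderIsomorphisms]
    {X Y : C} (e : X ≅ Y) {n : ℕ} (h : S (ModuleCat.of R (Ext.{w} N X n))) :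
    S (ModuleCat.of R (Ext.{w} N Y n)) :=
  S.prop_of_iso
    { hom := extPostcomp R N (Ext.mk₀ e.hom) (add_zero n)
      inv := extPostcomp R N (Ext.mk₀ e.inv) (add_zero n)
      hom_inv_id := by ext; simp [extPostcomp]
      inv_hom_id := by ext; simp [extPostcomp] } h

end Ext

section CochainBoundaries

variable {C : Type u₁} [Category.{v₁} C] [Abelian C] (K : CochainComplex C ℕ)

/-- The boundaries `Bⁿ ⊆ Zⁿ` of a cochain complex, encoded as the kernel of `Zⁿ ⟶ Hⁿ`. -/
noncomputable def cochainBoundaries (n : ℕ) : C := kernel (K.homologyπ n)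

namespace cochainBoundaries

/-- The inclusion `Bⁿ ⟶ Zⁿ`. -/
noncomputable def ι (n : ℕ) : cochainBoundaries K n ⟶ K.cycles n := kernel.ι (K.homologyπ n)

/-- The differential as a morphism `Kⁿ ⟶ Bⁿ⁺¹`. -/
noncomputable def fromX (n : ℕ) : K.X n ⟶ cochainBoundaries K (n + 1) :=
  kernel.lift _ (K.toCycles n (n + 1)) (K.toCycles_comp_homologyπ n (n + 1))

lemma fromX_ι (n : ℕ) : fromX K n ≫ ι K (n + 1) = K.toCycles n (n + 1) :=
  kernel.lift_ι _ _ _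

lemma shortExact_ι_homologyπ (n : ℕ) :
    (ShortComplex.mk (ι K n) (K.homologyπ n) (kernel.condition _)).ShortExact where
  exact := ShortComplex.exact_kernel _
  mono_f := inferInstanceAs (Mono (kernel.ι _))
  epi_g := inferInstanceAs (Epi (K.homologyπ n))

instance (n : ℕ) : Mono (ι K n) := (shortExact_ι_homologyπ K n).mono_f

instance (n : ℕ) : Epi (fromX K n) :=
  (ShortComplex.exact_of_g_is_cokernel (.mk _ _ (K.toCycles_comp_homologyπ n (n + 1)))
    (K.homologyIsCokernel n (n + 1) (by simp))).epi_kernelLift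

lemma fromX_ι_iCycles (n : ℕ) :
    fromX K n ≫ ι K (n + 1) ≫ K.iCycles (n + 1) = K.d n (n + 1) := by
  rw [← Category.assoc, fromX_ι, K.toCycles_i]

lemma iCycles_fromX (n : ℕ) : K.iCycles n ≫ fromX K n = 0 := by
  rw [← cancel_mono (ι K (n + 1) ≫ K.iCycles (n + 1)), Category.assoc, fromX_ι_iCycles,
    K.iCycles_d, zero_comp]

lemma shortExact_iCycles_fromX (n : ℕ) :
    (ShortComplex.mk (K.iCycles n) (fromX K n) (iCycles_fromX K n)).ShortExact where
  exact := ShortComplex.exact_of_f_is_kernel _ <| KernelFork.IsLimit.ofι' _ _ fun k hk =>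
    ⟨K.liftCycles k (n + 1) (by simp) (by rw [← fromX_ι_iCycles, reassoc_of% hk, zero_comp]),
      K.liftCycles_i _ _ _ _⟩
  mono_f := inferInstanceAs (Mono (K.iCycles n))
  epi_g := inferInstanceAs (Epi (fromX K n))

end cochainBoundaries

end CochainBoundaries

section HypercohomologyBound

variable {R : Type u} [CommRing R] (S : ObjectProperty (ModuleCat.{w} R)) [S.IsSerreClass]
  {C : Type u₁} [Category.{v₁} C] [Abelian C] [Linear R C] [HasExt.{w} C] (N : C)
  (K : CochainComplex C ℕ) [∀ n, Injective (K.X n)]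

lemma prop_ext_cycles (m k : ℕ) (h : ∀ p q, p + q = m + (k + 1) →
    p ≤ m → S (ModuleCat.of R (Ext.{w} N (K.homology p) q))) :
    S (ModuleCat.of R (Ext.{w} N (K.cycles m) (k + 1))) := by
  induction m generalizing k with
  | zero => exact prop_ext_of_iso N S (asIso (K.homologyπ 0)).symm (h 0 (k + 1) rfl le_rfl)
  | succ m ih =>
    have : Injective (ShortComplex.mk _ _ (cochainBoundaries.iCycles_fromX K m)).X₂ :=
      inferInstanceAs (Injective (K.X m))
    have hcycles : S (ModuleCat.of R (Ext.{w} N (K.cycles m) (k + 2))) :=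
      ih (k + 1) fun p q hpq hp => h p q (by lia) (by lia)
    have hboundaries : S (ModuleCat.of R (Ext.{w} N (cochainBoundaries K (m + 1)) (k + 1))) :=
      prop_ext_X₃_of_injective N (cochainBoundaries.shortExact_iCycles_fromX K m) S hcycles
    exact S.prop_X₂_of_exact
      (ext_exact₂ N (cochainBoundaries.shortExact_ι_homologyπ K (m + 1)) (k + 1)) hboundaries
      (h (m + 1) (k + 1) rfl le_rfl)

lemma prop_of_epi_ext_cycles (n : ℕ)
    (h : ∀ p q, p + q = n → S (ModuleCat.of R (Ext.{w} N (K.homology p) q)))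
    {P : ModuleCat.{w} R} (φ : ModuleCat.of R (Ext.{w} N (K.cycles n) 0) ⟶ P) [Epi φ]
    (hφ : ∀ i, extPostcomp R N (Ext.mk₀ (K.toCycles i n)) (add_zero 0) ≫ φ = 0) : S P := by
  cases n with
  | zero =>
    exact S.prop_of_epi φ (prop_ext_of_iso N S (asIso (K.homologyπ 0)).symm (h 0 0 rfl))
  | succ m =>
    have hcycles : S (ModuleCat.of R (Ext.{w} N (K.cycles m) 1)) :=
      prop_ext_cycles S N K m 0 fun p q hpq _ => h p q hpq
    have hboundaries : extPostcomp R N (Ext.mk₀.{w} (cochainBoundaries.fromX K m)) (add_zero 0) ≫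
        extPostcomp R N (Ext.mk₀ (cochainBoundaries.ι K (m + 1))) (add_zero 0) ≫ φ = 0 := by
      rw [← Category.assoc, extPostcomp_mk₀_comp, cochainBoundaries.fromX_ι, hφ]
    exact prop_of_exact_of_exact_of_epi S
      (ext_exact₃ N (cochainBoundaries.shortExact_iCycles_fromX K m) rfl) hcycles
      (ext_exact₂ N (cochainBoundaries.shortExact_ι_homologyπ K (m + 1)) 0) (h (m + 1) 0 rfl)
      φ hboundaries

end HypercohomologyBound

section ExtOfCycles

variable (R : Type u) [CommRing R] {C : Type u₁} [Category.{v₁} C] [Abelian C] [Linear R C]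
  [HasExt.{w} C] {M : C} (I : InjectiveResolution M) (N : C)

lemma smul_extMk (r : R) {n : ℕ} (f : N ⟶ I.cocomplex.X n) {m : ℕ} (hm : n + 1 = m)
    (hf : f ≫ I.cocomplex.d n m = 0) :
    r • I.extMk f m hm hf = I.extMk (r • f) m hm (by rw [Linear.smul_comp, hf, smul_zero]) := by
  have h := I.mk₀_comp_extMk f m hm hf (r • 𝟙 N)
  rw [Ext.mk₀_smul, Ext.smul_comp, Ext.mk₀_id_comp] at h
  simpa only [Linear.smul_comp, Category.id_comp] using h

/-- The class in `Extⁿ(N, M)` of a morphism from `N` to the cycles of an injective resolution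
of `M`. -/
noncomputable def extOfCycles (n : ℕ) : (N ⟶ I.cocomplex.cycles n) →ₗ[R] Ext.{w} N M n where
  toFun g := I.extMk (g ≫ I.cocomplex.iCycles n) (n + 1) rfl (by simp)
  map_add' g g' := by simp only [I.add_extMk, Preadditive.add_comp]
  map_smul' r g := by simp only [smul_extMk, Linear.smul_comp, RingHom.id_apply]

lemma extOfCycles_surjective (n : ℕ) :
    Function.Surjective (extOfCycles R I N n : _ → Ext.{w} N M n) := fun x => by
  obtain ⟨f, hf, rfl⟩ := I.extMk_surjective x (n + 1) rfl
  exact ⟨I.cocomplex.liftCycles f (n + 1) (by simp) hf, by simp [extOfCycles]⟩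

lemma extOfCycles_comp_toCycles {i n : ℕ} (g : N ⟶ I.cocomplex.X i) :
    (extOfCycles R I N n (g ≫ I.cocomplex.toCycles i n) : Ext.{w} N M n) = 0 := by
  by_cases hi : i + 1 = n
  · exact (I.extMk_eq_zero_iff _ _ rfl (by simp) i hi).2 ⟨g, by simp⟩
  · rw [I.cocomplex.toCycles_eq_zero hi, comp_zero, map_zero]

end ExtOfCycles

section CyclesTranspose

variable {R : Type u} [Ring R] {C : Type u₁} [Category.{v₁} C] [Preadditive C] [Linear R C]
  [CategoryWithHomology C] {D : Type u₂} [Category.{v₂} D] [Preadditive D] [Linear R D]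
  [CategoryWithHomology D] {J : CochainComplex D ℕ} {K : CochainComplex C ℕ} {N : D} {N' : C}
  (α : ∀ n, (N ⟶ J.X n) ≃ₗ[R] (N' ⟶ K.X n))
  (hα : ∀ i j g, α j (g ≫ J.d i j) = α i g ≫ K.d i j)

/-- The map `Hom(N, Zⁿ(J)) ⟶ Hom(N', Zⁿ(K))` induced by an isomorphism of complexes
`Hom(N, J) ≅ Hom(N', K)`. -/
noncomputable def cyclesTranspose (n : ℕ) : (N ⟶ J.cycles n) →ₗ[R] (N' ⟶ K.cycles n) where
  toFun g := K.liftCycles (α n (g ≫ J.iCycles n)) (n + 1) (by simp) (by simp [← hα])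
  map_add' g g' := by simp [← cancel_mono (K.iCycles n)]
  map_smul' r g := by simp [← cancel_mono (K.iCycles n)]

lemma cyclesTranspose_surjective (n : ℕ) : Function.Surjective (cyclesTranspose α hα n) := by
  intro g
  have hg : (α n).symm (g ≫ K.iCycles n) ≫ J.d n (n + 1) = 0 :=
    (α (n + 1)).injective (by simp [hα])
  exact ⟨J.liftCycles _ (n + 1) (by simp) hg,
    by simp [← cancel_mono (K.iCycles n), cyclesTranspose]⟩

lemma cyclesTranspose_comp_toCycles {i n : ℕ} (g : N ⟶ J.X i) :
    cyclesTranspose α hα n (g ≫ J.toCycles i n) = α i g ≫ K.toCycles i n := by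
  simp [← cancel_mono (K.iCycles n), cyclesTranspose, hα]

end CyclesTranspose

section ExtTranspose

variable {R : Type u} [CommRing R] {C : Type u₁} [Category.{v₁} C] [Abelian C] [Linear R C]
  [HasExt.{w} C] {D : Type u₂} [Category.{v₂} D] [Abelian D] [Linear R D] [HasExt.{w} D]
  {M : C} (I : InjectiveResolution M) {J : CochainComplex D ℕ} {N : D} {N' : C}
  (α : ∀ n, (N ⟶ J.X n) ≃ₗ[R] (N' ⟶ I.cocomplex.X n))
  (hα : ∀ i j g, α j (g ≫ J.d i j) = α i g ≫ I.cocomplex.d i j)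

/-- The map `Hom(N, Zⁿ(J)) ⟶ Extⁿ(N', M)` induced by an isomorphism of complexes
`Hom(N, J) ≅ Hom(N', I)`, where `I` is an injective resolution of `M`. Its source is written as
`Ext⁰(N, Zⁿ(J))`. -/
noncomputable def extTranspose (n : ℕ) : Ext.{w} N (J.cycles n) 0 →ₗ[R] Ext.{w} N' M n :=
  extOfCycles R I N' n ∘ₗ cyclesTranspose α hα n ∘ₗ Ext.linearEquiv₀.toLinearMap

lemma extTranspose_surjective (n : ℕ) :
    Function.Surjective (extTranspose I α hα n : Ext.{w} N (J.cycles n) 0 → Ext.{w} N' M n) :=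
  (extOfCycles_surjective R I N' n).comp
    ((cyclesTranspose_surjective α hα n).comp Ext.linearEquiv₀.surjective)

lemma extTranspose_comp_toCycles {i n : ℕ} (x : Ext.{w} N (J.X i) 0) :
    extTranspose I α hα n (x.comp (Ext.mk₀ (J.toCycles i n)) (add_zero 0)) = 0 := by
  obtain ⟨g, rfl⟩ := (Ext.mk₀_bijective _ _).2 x
  have hg : Ext.linearEquiv₀ (R := R) (Ext.mk₀.{w} (g ≫ J.toCycles i n)) = g ≫ J.toCycles i n :=
    Ext.linearEquiv₀.apply_symm_apply _
  simp only [Ext.mk₀_comp_mk₀, extTranspose, LinearMap.comp_apply, LinearEquiv.coe_coe,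
    hg, cyclesTranspose_comp_toCycles, extOfCycles_comp_toCycles]

end ExtTranspose

section Module

variable {R : Type u} [CommRing R] {M : Type*} [AddCommGroup M] [Module R M] (N : Submodule R M)
  {Q : Type*} [AddCommGroup Q] [Module R Q] (g : N →ₗ[R] Q)

lemma exists_pow_smul_top_inf_le_smul [IsNoetherianRing R] [Module.Finite R M] (𝔞 : Ideal R) :
    ∃ n : ℕ, 𝔞 ^ n • ⊤ ⊓ N ≤ 𝔞 • N := by
  obtain ⟨k, hk⟩ := 𝔞.exists_pow_inf_eq_pow_smul N
  refine ⟨k + 1, ?_⟩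
  rw [hk (k + 1) k.le_succ, Nat.add_sub_cancel_left, pow_one]
  exact Submodule.smul_mono le_rfl inf_le_right

lemma exists_forall_mem_pow_smul_top_apply_eq_zero [IsNoetherianRing R] [Module.Finite R M]
    {𝔞 : Ideal R} (h𝔞 : 𝔞 ≤ (LinearMap.range g).annihilator) :
    ∃ n : ℕ, ∀ x : N, (x : M) ∈ 𝔞 ^ n • (⊤ : Submodule R M) → g x = 0 := by
  obtain ⟨n, hn⟩ := exists_pow_smul_top_inf_le_smul N 𝔞
  have hsmul : 𝔞 • N ≤ (LinearMap.ker g).map N.subtype := Submodule.smul_le.2 fun r hr y hy =>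
    ⟨r • ⟨y, hy⟩, (map_smul g r ⟨y, hy⟩).trans <|
      Submodule.mem_annihilator.1 (h𝔞 hr) _ (LinearMap.mem_range_self g ⟨y, hy⟩), rfl⟩
  refine ⟨n, fun x hx => ?_⟩
  obtain ⟨y, hy, hyx⟩ := hsmul (hn ⟨hx, x.2⟩)
  exact Subtype.ext hyx ▸ hy

lemma exists_extension_vanishing_on (hQ : Module.Baer R Q) {K : Submodule R M}
    (hK : ∀ x : N, (x : M) ∈ K → g x = 0) :
    ∃ e : M →ₗ[R] Q, e ∘ₗ N.subtype = g ∧ K ≤ LinearMap.ker e := by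
  let q : N →ₗ[R] M ⧸ K := K.mkQ ∘ₗ N.subtype
  have hq : LinearMap.ker q ≤ LinearMap.ker g := fun x hx =>
    hK x ((Submodule.Quotient.mk_eq_zero K).1 hx)
  obtain ⟨e, he⟩ := hQ.extension_property ((LinearMap.ker q).liftQ q le_rfl)
    (LinearMap.ker_eq_bot.1 (Submodule.ker_liftQ_eq_bot _ _ _ le_rfl))
    ((LinearMap.ker q).liftQ g hq)
  refine ⟨e ∘ₗ K.mkQ, ?_, ?_⟩
  · ext x
    exact LinearMap.congr_fun he (Submodule.Quotient.mk x)
  · exact K.ker_mkQ.symm.le.trans (LinearMap.ker_le_ker_comp _ _)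

end Module

namespace SystemOfIdeals

variable {R : Type u} [CommRing R] (Φ : SystemOfIdeals R) {M : Type v} [AddCommGroup M] [Module R M]

lemma exists_le_pow {𝔞 : Ideal R} (h𝔞 : 𝔞 ∈ Φ.ideals) (n : ℕ) : ∃ 𝔟 ∈ Φ.ideals, 𝔟 ≤ 𝔞 ^ n := by
  induction n with
  | zero => exact ⟨𝔞, h𝔞, by simp⟩
  | succ n ih =>
    obtain ⟨𝔟, h𝔟, hle⟩ := ih
    obtain ⟨𝔠, h𝔠, hle'⟩ := Φ.exists_le_mul 𝔟 h𝔟 𝔞 h𝔞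
    exact ⟨𝔠, h𝔠, hle'.trans (pow_succ 𝔞 n ▸ Ideal.mul_mono_left hle)⟩

lemma exists_le_annihilator_of_fg {P : Submodule R M} (hP : P.FG) (hle : P ≤ Φ.gamma M) :
    ∃ 𝔞 ∈ Φ.ideals, 𝔞 ≤ P.annihilator := by
  induction P, hP using Submodule.fg_induction with
  | singleton x =>
    obtain ⟨𝔞, h𝔞, hx⟩ := hle (Submodule.mem_span_singleton_self x)
    exact ⟨𝔞, h𝔞, fun r hr => (Submodule.mem_annihilator_span_singleton x r).2 (hx r hr)⟩
  | sup P Q _ _ ihP ihQ =>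
    obtain ⟨𝔞, h𝔞, hP⟩ := ihP (le_sup_left.trans hle)
    obtain ⟨𝔟, h𝔟, hQ⟩ := ihQ (le_sup_right.trans hle)
    obtain ⟨𝔠, h𝔠, hc⟩ := Φ.exists_le_mul 𝔞 h𝔞 𝔟 h𝔟
    refine ⟨𝔠, h𝔠, hc.trans ?_⟩
    rw [Submodule.annihilator_sup]
    exact Ideal.mul_le_inf.trans (inf_le_inf hP hQ)

lemma exists_forall_mem_smul_top_apply_eq_zero [IsNoetherianRing R] {L : Type*} [AddCommGroup L]
    [Module R L] [Module.Finite R L] (N : Submodule R L) (g : N →ₗ[R] M)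
    (hg : LinearMap.range g ≤ Φ.gamma M) :
    ∃ 𝔟 ∈ Φ.ideals, ∀ x : N, (x : L) ∈ 𝔟 • (⊤ : Submodule R L) → g x = 0 := by
  obtain ⟨𝔞, h𝔞, hle⟩ :=
    Φ.exists_le_annihilator_of_fg (Module.Finite.iff_fg.1 (Module.Finite.range g)) hg
  obtain ⟨n, hn⟩ := exists_forall_mem_pow_smul_top_apply_eq_zero N g hle
  obtain ⟨𝔟, h𝔟, hpow⟩ := Φ.exists_le_pow h𝔞 n
  exact ⟨𝔟, h𝔟, fun x hx => hn x (Submodule.smul_mono_left hpow hx)⟩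

lemma baer_gamma [IsNoetherianRing R] (hM : Module.Baer R M) : Module.Baer R (Φ.gamma M) := by
  intro I g
  obtain ⟨𝔟, h𝔟, hg⟩ := Φ.exists_forall_mem_smul_top_apply_eq_zero I
    ((Φ.gamma M).subtype ∘ₗ g) (by rintro _ ⟨x, rfl⟩; exact (g x).2)
  obtain ⟨e, he, hker⟩ := exists_extension_vanishing_on I _ hM hg
  have hmem (x : R) : e x ∈ Φ.gamma M := ⟨𝔟, h𝔟, fun r hr => by
    rw [← map_smul]
    exact hker (Submodule.smul_mem_smul hr Submodule.mem_top)⟩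
  exact ⟨e.codRestrict _ hmem, fun x hx => Subtype.ext (LinearMap.congr_fun he ⟨x, hx⟩)⟩

instance [IsNoetherianRing R] [Small.{v} R] :
    (Φ.gammaFunctor : ModuleCat.{v} R ⥤ ModuleCat.{v} R).PreservesInjectiveObjects where
  injective_obj {M} hM := by
    have hbaer : Module.Baer R M :=
      Module.Baer.of_injective ((Module.injective_iff_injective_object R M).2 hM)
    exact (Module.injective_iff_injective_object R _).1 (Φ.baer_gamma hbaer).injective

/-- A morphism from a `Φ`-torsion module `N` to `X` factors uniquely through `Γ_Φ(X)`. -/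
def IsTorsion.homGammaEquiv {Φ : SystemOfIdeals R} {N : ModuleCat.{v} R} (hN : Φ.IsTorsion N)
    (X : ModuleCat.{v} R) : (N ⟶ Φ.gammaFunctor.obj X) ≃ₗ[R] (N ⟶ X) where
  toFun g := g ≫ ModuleCat.ofHom (Φ.gamma X).subtype
  map_add' _ _ := rfl
  map_smul' _ _ := rfl
  invFun g := ModuleCat.ofHom <| g.hom.codRestrict (Φ.gamma X) fun x =>
    Φ.map_mem_gamma g.hom x (hN ▸ Submodule.mem_top)
  left_inv _ := rfl
  right_inv _ := rfl

end SystemOfIdeals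

theorem theorem2p1_general {R : Type u} [CommRing R]
    {C : Type u₁} [Category.{v₁} C] [Abelian C] [Linear R C] [HasExt.{w} C]
    [HasInjectiveResolutions C] {D : Type u₂} [Category.{v₂} D] [Abelian D] [Linear R D]
    [HasExt.{w} D] (F : C ⥤ D) [F.Additive] [F.PreservesInjectiveObjects] {N : D} {N' : C}
    (α : ∀ X, (N ⟶ F.obj X) ≃ₗ[R] (N' ⟶ X))
    (hα : ∀ {X Y : C} (f : X ⟶ Y) (g : N ⟶ F.obj X), α Y (g ≫ F.map f) = α X g ≫ f)
    (S : ObjectProperty (ModuleCat.{w} R)) [S.IsSerreClass] (M : C) (t : ℕ)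
    (h : ∀ i ≤ t, S (ModuleCat.of R (Ext.{w} N ((F.rightDerived i).obj M) (t - i)))) :
    S (ModuleCat.of R (Ext.{w} N' M t)) := by
  let I := injectiveResolution M
  let J := (F.mapHomologicalComplex _).obj I.cocomplex
  have hJ (n : ℕ) : Injective (J.X n) := F.injective_obj (I.cocomplex.X n)
  have hhomology (p q : ℕ) (hpq : p + q = t) : S (ModuleCat.of R (Ext.{w} N (J.homology p) q)) := by
    obtain rfl : q = t - p := by lia
    exact prop_ext_of_iso N S (I.isoRightDerivedObj F p) (h p (by lia))
  let β (n : ℕ) : (N ⟶ J.X n) ≃ₗ[R] (N' ⟶ I.cocomplex.X n) := α (I.cocomplex.X n)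
  have hβ (i j : ℕ) (g : N ⟶ J.X i) : β j (g ≫ J.d i j) = β i g ≫ I.cocomplex.d i j := hα _ g
  have : Epi (ModuleCat.ofHom (extTranspose I β hβ t)) :=
    (ModuleCat.epi_iff_surjective _).2 (extTranspose_surjective I β hβ t)
  refine prop_of_epi_ext_cycles S N J t hhomology (ModuleCat.ofHom (extTranspose I β hβ t))
    fun i => ?_
  ext x
  exact extTranspose_comp_toCycles I β hβ x

theorem theorem2p1 {R : Type u} [CommRing R] [IsNoetherianRing R] [Small.{v} R]
    (Φ : SystemOfIdeals R)
    (S : ObjectProperty (ModuleCat.{v} R)) [S.IsSerreClass]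
    (M N : ModuleCat.{v} R) (hN : Φ.IsTorsion N) (t : ℕ)
    (h : ∀ i : ℕ, i ≤ t →
      S (ModuleCat.of R (Abelian.Ext.{v} N ((Φ.localCohomology i).obj M) (t - i)))) :
    S (ModuleCat.of R (Abelian.Ext.{v} N M t)) :=
  theorem2p1_general Φ.gammaFunctor hN.homGammaEquiv (fun _ _ => rfl) S M t h
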